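/- All rings are unitary and not necessarily commutative, homomorphisms preserve $1$, and $U(B)$ denotes the group of units of $B$. For a ring $A$ and a subset $S\subset A$, let $A_S$ be the localization of $A$ at $S$, i.e. the ring with presentation $\langle A,\{x_s\}_{s\in S}\mid x_ss=sx_s=1\rangle$; write $A_a=A_{\{a\}}$. A homomorphism $\varphi:A\to B$ to a nonzero ring $B$ gives, by successive localization, a sequence $\mathcal S=(S_1,S_2,\dots)$: put $A_0=A$, $\varphi_0=\varphi$, and inductively $S_{n+1}=\varphi_n^{-1}(U(B))$, $A_{n+1}=(A_n)_{S_{n+1}}$, and let $\varphi_{n+1}:A_{n+1}\to B$ be the induced extension of $\varphi_n$. The sequences obtained in this way are the fully invertible systems on $A$; the set of them is the full spectrum $\mathrm F(A)$. For $\mathcal S\in \mathrm F(A)$ write $A_{\mathcal S,n}$ for the ring $A_n$ built from $S_1,\dots,S_n$, and $A_{\mathcal S}=\varinjlim_n A_{\mathcal S,n}$. A fraction of $A$ is a finite sequence $\mathbf a=(a_1,\dots,a_n)$ with $a_1\in A$, $a_2\in A_{a_1}$, $\dots$, $a_n\in(\cdots(A_{a_1})_{a_2}\cdots)_{a_{n-1}}$,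 and $A_{\mathbf a}=(\cdots(A_{a_1})_{a_2}\cdots)_{a_n}$. For $\mathcal S\in\mathrm F(A)$ write $\mathbf a\in\mathcal S$ if successively, for $i=1,\dots,n$, the image of $a_i$ in $A_{\mathcal S,i-1}$ lies in $S_i$, and put $D(\mathbf a)=\{\mathcal S\in\mathrm F(A)\mid \mathbf a\in\mathcal S\}$. The set $\mathrm F(A)$ carries the topology generated by the sets $D(\mathbf a)$, and the sheaf of rings $\mathcal O_A$ for which $\mathcal O_A(U)$ is the ring of all functions $t$ assigning to each $\mathcal S\in U$ an element $t(\mathcal S)\in A_{\mathcal S}$ that are locally given by one polynomial presentation: every $\mathcal S_0\in U$ has an open neighbourhood $U_0\subset U$ on which $$t(\mathcal S)=f\bigl(b_1,\dots,b_m,\,x_{s_{11}},\dots,x_{s_{1n_1}},\dots,x_{s_{k1}},\dots,x_{s_{kn_k}}\bigr)\quad\text{in }A_{\mathcal S}\qquad(\mathcal S\in U_0)$$ with a fixed noncommutative integer polynomial $f$ and fixed $b_i\in A$, where $x_{s_{ij}}$ is the inverse of $s_{ij}$, each $s_{ij}$ is given by a fixed noncommutative integer polynomial in elements of $A$ and the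 $x_{s_{pq}}$ with $p<i$, and $s_{ij}\in S_i$ for every $\mathcal S=(S_1,S_2,\dots)\in U_0$. An affine F-scheme is a ringed space isomorphic to $(\mathrm F(A),\mathcal O_A)$ for some nonzero ring $A$. An F-scheme is a ringed space each of whose points has an open neighbourhood $U$ such that the open ringed subspace $(U,\mathcal O_X|_U)$ is an affine F-scheme. An open sub-F-scheme of an F-scheme is an open ringed subspace of it. **Proposition.** (1) For any ring $A$ and any fraction $\mathbf a$ of $A$ such that $D(\mathbf a)\neq\emptyset$, the ring $A_{\mathbf a}$ is nonzero and there is an isomorphism of ringed spaces $$(D(\mathbf a),\mathcal O_A|_{D(\mathbf a)})\cong(\mathrm F(A_{\mathbf a}),\mathcal O_{A_{\mathbf a}}).$$ (2) Consequently, every open sub-F-scheme of an F-scheme is an F-scheme. -/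

import Mathlib

open CategoryTheory CategoryTheory.Limits TopologicalSpace Opposite AlgebraicGeometry

universe u

noncomputable section

namespace FSch

/-! ### Localization of a (not necessarily commutative) ring at a subset -/

/-- The defining relations of `A_S = ⟨A, {x_s}_{s ∈ S} | x_s s = s x_s = 1⟩`: the first three say
that `A` maps in by a unital ring homomorphism. -/
inductive LocRel (A : Type u) [Ring A] (S : Set A) :
    FreeAlgebra ℤ (A ⊕ S) → FreeAlgebra ℤ (A ⊕ S) → Prop
  | one : LocRel A S (FreeAlgebra.ι ℤ (Sum.inl 1)) 1
  | add (a b : A) : LocRel A S (FreeAlgebra.ι ℤ (Sum.inl (a + b)))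
      (FreeAlgebra.ι ℤ (Sum.inl a) + FreeAlgebra.ι ℤ (Sum.inl b))
  | mul (a b : A) : LocRel A S (FreeAlgebra.ι ℤ (Sum.inl (a * b)))
      (FreeAlgebra.ι ℤ (Sum.inl a) * FreeAlgebra.ι ℤ (Sum.inl b))
  | inv_mul (s : S) : LocRel A S
      (FreeAlgebra.ι ℤ (Sum.inr s) * FreeAlgebra.ι ℤ (Sum.inl s.1)) 1
  | mul_inv (s : S) : LocRel A S
      (FreeAlgebra.ι ℤ (Sum.inl s.1) * FreeAlgebra.ι ℤ (Sum.inr s)) 1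

/-- The localization `A_S`. -/
def Loc (A : Type u) [Ring A] (S : Set A) : Type u := RingQuot (LocRel A S)

namespace Loc

variable {A : Type u} [Ring A] (S : Set A)

instance : Ring (Loc A S) := inferInstanceAs (Ring (RingQuot (LocRel A S)))

/-- The quotient map from the free ring on the generators. -/
def mk : FreeAlgebra ℤ (A ⊕ S) →+* Loc A S := RingQuot.mkRingHom (LocRel A S)

/-- The canonical homomorphism `i_S : A → A_S`. -/
def of : A →+* Loc A S :=
  RingHom.mk' ⟨⟨fun a => mk S (FreeAlgebra.ι ℤ (Sum.inl a)),
      (RingQuot.mkRingHom_rel LocRel.one).trans (map_one (mk S))⟩,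
    fun a b => (RingQuot.mkRingHom_rel (LocRel.mul a b)).trans (map_mul (mk S) _ _)⟩
    fun a b => (RingQuot.mkRingHom_rel (LocRel.add a b)).trans (map_add (mk S) _ _)

/-- The adjoined inverse `x_s`. -/
def inv (s : S) : Loc A S := mk S (FreeAlgebra.ι ℤ (Sum.inr s))

theorem inv_mul (s : S) : inv S s * of S s.1 = 1 :=
  ((map_mul (mk S) _ _).symm.trans (RingQuot.mkRingHom_rel (LocRel.inv_mul s))).trans
    (map_one (mk S))

theorem mul_inv (s : S) : of S s.1 * inv S s = 1 :=
  ((map_mul (mk S) _ _).symm.trans (RingQuot.mkRingHom_rel (LocRel.mul_inv s))).trans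
    (map_one (mk S))

theorem isUnit_of {s : A} (hs : s ∈ S) : IsUnit (of S s) :=
  ⟨⟨of S s, inv S ⟨s, hs⟩, mul_inv S ⟨s, hs⟩, inv_mul S ⟨s, hs⟩⟩, rfl⟩

variable {B : Type*} [Ring B]

/-- The homomorphism `φ_S : A_S → B` with `φ = φ_S i_S`, for `φ` inverting `S`. -/
def lift (φ : A →+* B) (h : ∀ s ∈ S, IsUnit (φ s)) : Loc A S →+* B :=
  RingQuot.lift ⟨(FreeAlgebra.lift ℤ
      (Sum.elim φ fun s : S => ((h s.1 s.2).unit⁻¹ : Bˣ).1)).toRingHom, by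
    intro x y hxy
    induction hxy <;> simp⟩

theorem lift_of (φ : A →+* B) (h : ∀ s ∈ S, IsUnit (φ s)) (a : A) :
    lift S φ h (of S a) = φ a := by
  refine (RingQuot.lift_mkRingHom_apply _ _ _).trans ?_
  simp

theorem hom_ext {f g : Loc A S →+* B} (h : f.comp (of S) = g.comp (of S)) : f = g := by
  have hl : ∀ a, f (of S a) = g (of S a) := fun a => RingHom.congr_fun h a
  refine RingQuot.ringQuot_ext (r := LocRel A S) f g ?_
  let f' : FreeAlgebra ℤ (A ⊕ S) →ₐ[ℤ] B := (f.comp (mk S)).toIntAlgHom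
  let g' : FreeAlgebra ℤ (A ⊕ S) →ₐ[ℤ] B := (g.comp (mk S)).toIntAlgHom
  have : f' = g' := by
    refine FreeAlgebra.hom_ext ?_
    funext x
    rcases x with a | s
    · exact hl a
    · change f (inv S s) = g (inv S s)
      refine left_inv_eq_right_inv (a := f (of S s.1)) ?_ ?_
      · rw [← map_mul, inv_mul, map_one]
      · rw [hl, ← map_mul, mul_inv, map_one]
  exact congrArg (fun k : FreeAlgebra ℤ (A ⊕ S) →ₐ[ℤ] B => (k : FreeAlgebra ℤ (A ⊕ S) →+* B)) this

end Loc

/-! ### Fully invertible systems and their localizations -/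

/-- The sequences `(S_1, …, S_n)` of subsets `S_k ⊆ A_{k-1}`, where `A_0 = A` and
`A_k = (A_{k-1})_{S_k}`, each together with its ring `A_n`. -/
def Stage (A : RingCat.{u}) : ℕ → Σ T : Type u, (T → RingCat.{u})
  | 0 => ⟨PUnit, fun _ => A⟩
  | n + 1 => ⟨Σ p : (Stage A n).1, Set ((Stage A n).2 p),
      fun p => RingCat.of (Loc ((Stage A n).2 p.1) p.2)⟩

/-- The sequences `(S_1, …, S_n)` as above. -/
abbrev Chain (A : RingCat.{u}) (n : ℕ) : Type u := (Stage A n).1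

/-- The ring `A_n` belonging to `(S_1, …, S_n)`. -/
abbrev Chain.ring {A : RingCat.{u}} {n : ℕ} (p : Chain A n) : RingCat.{u} := (Stage A n).2 p

/-- The chain `(S_1, …, S_{n-1})` of a chain `(S_1, …, S_n)`. -/
def Chain.init {A : RingCat.{u}} {n : ℕ} (p : Chain A (n + 1)) : Chain A n := p.1

/-- The set `S_n ⊆ A_{n-1}` of a chain `(S_1, …, S_n)`. -/
def Chain.last {A : RingCat.{u}} {n : ℕ} (p : Chain A (n + 1)) : Set p.init.ring := p.2

/-- The map `A_{n-1} → A_n = (A_{n-1})_{S_n}`. -/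
def Chain.map {A : RingCat.{u}} {n : ℕ} (p : Chain A (n + 1)) : p.init.ring →+* p.ring :=
  Loc.of p.last

/-- The identity of `A_n`, for propositionally equal chains. -/
def Chain.cast {A : RingCat.{u}} {n : ℕ} {p q : Chain A n} (h : p = q) : p.ring →+* q.ring :=
  h ▸ RingHom.id _

/-- Successive localization along `φ : A → B`: the chain `(S_1, …, S_n)` and the homomorphism
`φ_n : A_n → B`, where `φ_0 = φ`, `S_{n+1} = φ_n⁻¹(U(B))`, and `φ_{n+1}` is the extension of `φ_n`
to `A_{n+1} = (A_n)_{S_{n+1}}`. -/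
def succLoc {A B : RingCat.{u}} (φ : A →+* B) : ∀ n, Σ p : Chain A n, (p.ring →+* B)
  | 0 => ⟨PUnit.unit, φ⟩
  | n + 1 => ⟨⟨(succLoc φ n).1, {x | IsUnit ((succLoc φ n).2 x)}⟩,
      Loc.lift _ (succLoc φ n).2 fun _ h => h⟩

/-- A fully invertible system `(S_1, S_2, …)` on `A`, given by its initial segments: a sequence
that comes from some homomorphism from `A` to a nonzero ring by successive localization. The
collection of all of them is the full spectrum `F(A)`. -/
@[ext] structure FullSpec (A : RingCat.{u}) : Type u where
  chain : ∀ n, Chain A n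
  exists_hom : ∃ (B : RingCat.{u}) (_ : Nontrivial B) (φ : A →+* B),
    ∀ n, chain n = (succLoc φ n).1

namespace FullSpec

variable {A : RingCat.{u}} (S : FullSpec A)

theorem chain_init (n : ℕ) : Chain.init (S.chain (n + 1)) = S.chain n := by
  obtain ⟨B, _, φ, h⟩ := S.exists_hom
  rw [h, h]
  rfl

/-- The ring `A_{𝒮,n}`; `A_{𝒮,0}` is `A` by definition. -/
abbrev ring (n : ℕ) : RingCat.{u} := (S.chain n).ring

/-- `S.set n ⊆ A_{𝒮,n}` is the set `S_{n+1}` of the system `(S_1, S_2, …)`. -/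
def set (n : ℕ) : Set (S.ring n) :=
  {x | Chain.cast (S.chain_init n).symm x ∈ Chain.last (S.chain (n + 1))}

/-- The localization map `A_{𝒮,n} → A_{𝒮,n+1} = (A_{𝒮,n})_{S_{n+1}}`. -/
def step (n : ℕ) : S.ring n →+* S.ring (n + 1) :=
  (Chain.map (S.chain (n + 1))).comp (Chain.cast (S.chain_init n).symm)

theorem isUnit_step {n : ℕ} {x : S.ring n} (hx : x ∈ S.set n) : IsUnit (S.step n x) :=
  Loc.isUnit_of _ hx

/-- The localization `A_𝒮`, the direct limit of `A = A_{𝒮,0} → A_{𝒮,1} → A_{𝒮,2} → ⋯`. -/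
def loc : RingCat.{u} :=
  colimit (Functor.ofSequence (X := S.ring) fun n => RingCat.ofHom (S.step n))

/-- The canonical map `A_{𝒮,n} → A_𝒮`. -/
def toLoc (n : ℕ) : S.ring n →+* S.loc :=
  (colimit.ι (Functor.ofSequence (X := S.ring) fun n => RingCat.ofHom (S.step n)) n).hom

/-- The canonical map `i_𝒮 : A → A_𝒮`. -/
def fromBase : A →+* S.loc := S.toLoc 0

end FullSpec

/-! ### Fractions and the topology of the full spectrum -/

/-- A fraction `(a_1, …, a_n)` of `A`: `a_1 ∈ A`, and `(a_2, …, a_n)` is a fraction of `A_{a_1}`. -/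
inductive Fraction : RingCat.{u} → Type (u + 1)
  | nil (A : RingCat.{u}) : Fraction A
  | cons {A : RingCat.{u}} (a : A) (t : Fraction (RingCat.of (Loc A {a}))) : Fraction A

/-- The ring `A_𝐚 = (…((A_{a_1})_{a_2})…)_{a_n}`. -/
def Fraction.ring : ∀ {A : RingCat.{u}}, Fraction A → RingCat.{u}
  | A, .nil _ => A
  | _, .cons _ t => t.ring

/-- For a homomorphism `f : R → A_{𝒮,k}` and a fraction `(a_1, …, a_n)` of `R`: the successive
images of the `a_i` under `R → A_{𝒮,k}`, `R_{a_1} → A_{𝒮,k+1}`, … lie in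
`S_{k+1}`, `S_{k+2}`, …. -/
def Fraction.MemAux {A : RingCat.{u}} (S : FullSpec A) :
    ∀ {R : RingCat.{u}}, Fraction R → ∀ k : ℕ, (R →+* S.ring k) → Prop
  | _, .nil _, _, _ => True
  | _, .cons a t, k, f => ∃ h : f a ∈ S.set k,
      t.MemAux S (k + 1) (Loc.lift {a} ((S.step k).comp f) (by
        rintro _ rfl
        exact S.isUnit_step h))

/-- The relation `𝐚 ∈ 𝒮`: `a_i ∈ S_i` for all `i`. -/
def Fraction.Mem {A : RingCat.{u}} (a : Fraction A) (S : FullSpec A) : Prop :=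
  a.MemAux S 0 (RingHom.id A)

/-- The topology of `F(A)` generated by the sets `D(𝐚) = {𝒮 | 𝐚 ∈ 𝒮}`. -/
instance (A : RingCat.{u}) : TopologicalSpace (FullSpec A) :=
  TopologicalSpace.generateFrom (Set.range fun a : Fraction A => {S | a.Mem S})

/-- The full spectrum as an object of the category of topological spaces. -/
abbrev top (A : RingCat.{u}) : TopCat.{u} := TopCat.of (FullSpec A)

/-- The fundamental open set `D(𝐚) = {𝒮 ∈ F(A) | 𝐚 ∈ 𝒮}`. -/
def D {A : RingCat.{u}} (a : Fraction A) : Opens (top A) :=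
  ⟨{S | a.Mem S}, TopologicalSpace.isOpen_generateFrom_of_mem ⟨a, rfl⟩⟩

/-! ### The structure sheaf -/

/-- Formal data of a polynomial presentation `f(a_1, …, a_m, x_{s_11}, …, x_{s_kn_k})`: finitely
many indices `j`, each with a level; for each `j` a noncommutative polynomial `den j` in elements
of `A` and the variables of smaller level, which presents `s_j`; and a noncommutative polynomial
`num` in elements of `A` and all the variables `x_{s_j}`. Levels are counted from `0`, so that
`s_j` of level `n` belongs to `S_{n+1} ⊆ A_{𝒮,n}`. -/
structure PolyPres (A : RingCat.{u}) where
  Idx : Type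
  finite : Finite Idx
  level : Idx → ℕ
  den : ∀ j : Idx, FreeAlgebra ℤ (A ⊕ {i : Idx // level i < level j})
  num : FreeAlgebra ℤ (A ⊕ Idx)

/-- The value in `A_𝒮` of a noncommutative polynomial in elements of `A` and variables `I`. -/
def evalAt {A : RingCat.{u}} (S : FullSpec A) {I : Type} (x : I → S.loc) :
    FreeAlgebra ℤ (A ⊕ I) →ₐ[ℤ] S.loc :=
  FreeAlgebra.lift ℤ (Sum.elim S.fromBase x)

/-- The assignment `x` gives the variables of the presentation `P` their meaning in `A_𝒮`: each
`den j` presents an element `s_j` of the appropriate set of `𝒮`, whose inverse is `x j`. -/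
def PolyPres.IsAssignment {A : RingCat.{u}} (P : PolyPres A) (S : FullSpec A)
    (x : P.Idx → S.loc) : Prop :=
  ∀ j : P.Idx, ∃ s ∈ S.set (P.level j),
    S.toLoc _ s = evalAt S (fun i : {i : P.Idx // P.level i < P.level j} => x i.1) (P.den j) ∧
    x j * S.toLoc _ s = 1 ∧ S.toLoc _ s * x j = 1

/-- `P` presents the element `y` of `A_𝒮`. -/
def PolyPres.Presents {A : RingCat.{u}} (P : PolyPres A) (S : FullSpec A) (y : S.loc) : Prop :=
  ∃ x : P.Idx → S.loc, P.IsAssignment S x ∧ y = evalAt S x P.num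

/-- The presentation with no variables. -/
def PolyPres.const {A : RingCat.{u}} (a : A) : PolyPres A where
  Idx := Empty
  finite := inferInstance
  level := Empty.elim
  den := fun j => j.elim
  num := FreeAlgebra.ι ℤ (Sum.inl a)

theorem PolyPres.const_presents {A : RingCat.{u}} (a : A) (S : FullSpec A) :
    (PolyPres.const a).Presents S (S.fromBase a) :=
  ⟨Empty.elim, fun j => j.elim,
    (FreeAlgebra.lift_ι_apply (R := ℤ) (Sum.elim S.fromBase Empty.elim) (Sum.inl a)).symm⟩

/-- Renaming of variables. -/
def rename {A : RingCat.{u}} {I J : Type} (g : I → J) :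
    FreeAlgebra ℤ (A ⊕ I) →ₐ[ℤ] FreeAlgebra ℤ (A ⊕ J) :=
  FreeAlgebra.lift ℤ fun z => FreeAlgebra.ι ℤ (Sum.map id g z)

theorem evalAt_rename {A : RingCat.{u}} (S : FullSpec A) {I J : Type} (g : I → J)
    (x : J → S.loc) (p : FreeAlgebra ℤ (A ⊕ I)) :
    evalAt S x (rename g p) = evalAt S (x ∘ g) p := by
  have : (evalAt S x).comp (rename g) = evalAt S (x ∘ g) := by
    refine FreeAlgebra.hom_ext ?_
    funext z
    rcases z with a | i <;> simp [evalAt, rename]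
  exact DFunLike.congr_fun this p

/-- Two presentations side by side, with a new polynomial `f` in all the variables. -/
def PolyPres.combine {A : RingCat.{u}} (P Q : PolyPres A)
    (f : FreeAlgebra ℤ (A ⊕ (P.Idx ⊕ Q.Idx))) : PolyPres A where
  Idx := P.Idx ⊕ Q.Idx
  finite := by
    have := P.finite
    have := Q.finite
    infer_instance
  level := Sum.elim P.level Q.level
  den
    | .inl j => rename (fun i => ⟨.inl i.1, i.2⟩) (P.den j)
    | .inr j => rename (fun i => ⟨.inr i.1, i.2⟩) (Q.den j)
  num := f

theorem PolyPres.combine_isAssignment {A : RingCat.{u}} {P Q : PolyPres A} {S : FullSpec A}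
    {x : P.Idx → S.loc} {y : Q.Idx → S.loc} (hx : P.IsAssignment S x) (hy : Q.IsAssignment S y)
    (f : FreeAlgebra ℤ (A ⊕ (P.Idx ⊕ Q.Idx))) :
    (P.combine Q f).IsAssignment S (Sum.elim x y) := by
  rintro (j | j)
  · obtain ⟨s, hs, h1, h2⟩ := hx j
    refine ⟨s, hs, h1.trans ?_, h2⟩
    exact (evalAt_rename S (J := {i : P.Idx ⊕ Q.Idx // Sum.elim P.level Q.level i < P.level j})
      (fun i => ⟨.inl i.1, i.2⟩) (fun i => Sum.elim x y i.1) (P.den j)).symm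
  · obtain ⟨s, hs, h1, h2⟩ := hy j
    refine ⟨s, hs, h1.trans ?_, h2⟩
    exact (evalAt_rename S (J := {i : P.Idx ⊕ Q.Idx // Sum.elim P.level Q.level i < Q.level j})
      (fun i => ⟨.inr i.1, i.2⟩) (fun i => Sum.elim x y i.1) (Q.den j)).symm

theorem PolyPres.add_presents {A : RingCat.{u}} {P Q : PolyPres A} {S : FullSpec A} {y z : S.loc}
    (hy : P.Presents S y) (hz : Q.Presents S z) :
    (P.combine Q (rename .inl P.num + rename .inr Q.num)).Presents S (y + z) := by
  obtain ⟨v, hv, rfl⟩ := hy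
  obtain ⟨w, hw, rfl⟩ := hz
  refine ⟨Sum.elim v w, combine_isAssignment hv hw _, ?_⟩
  have h1 := evalAt_rename S Sum.inl (Sum.elim v w) P.num
  have h2 := evalAt_rename S Sum.inr (Sum.elim v w) Q.num
  rw [Sum.elim_comp_inl] at h1
  rw [Sum.elim_comp_inr] at h2
  rw [← h1, ← h2]
  exact (map_add (evalAt S (Sum.elim v w)) _ _).symm

theorem PolyPres.mul_presents {A : RingCat.{u}} {P Q : PolyPres A} {S : FullSpec A} {y z : S.loc}
    (hy : P.Presents S y) (hz : Q.Presents S z) :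
    (P.combine Q (rename .inl P.num * rename .inr Q.num)).Presents S (y * z) := by
  obtain ⟨v, hv, rfl⟩ := hy
  obtain ⟨w, hw, rfl⟩ := hz
  refine ⟨Sum.elim v w, combine_isAssignment hv hw _, ?_⟩
  have h1 := evalAt_rename S Sum.inl (Sum.elim v w) P.num
  have h2 := evalAt_rename S Sum.inr (Sum.elim v w) Q.num
  rw [Sum.elim_comp_inl] at h1
  rw [Sum.elim_comp_inr] at h2
  rw [← h1, ← h2]
  exact (map_mul (evalAt S (Sum.elim v w)) _ _).symm

/-- The functions `t` on `U` with `t(𝒮) ∈ A_𝒮` that have one polynomial presentation on `U`. -/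
def isPresented (A : RingCat.{u}) : TopCat.PrelocalPredicate fun S : top A => S.loc where
  pred {U} t := ∃ P : PolyPres A, ∀ S : U, P.Presents S.1 (t S)
  res := by
    rintro V U i t ⟨P, h⟩
    exact ⟨P, fun S => h ⟨S.1, i.le S.2⟩⟩

/-- The functions `t` on `U` with `t(𝒮) ∈ A_𝒮` that locally have a polynomial presentation. -/
def isSection (A : RingCat.{u}) : TopCat.LocalPredicate fun S : top A => S.loc :=
  (isPresented A).sheafify

/-- The ring `𝒪_A(U)`. -/
def sections (A : RingCat.{u}) (U : (Opens (top A))ᵒᵖ) : Subring (∀ S : U.unop, S.1.loc) where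
  carrier := {t | (isSection A).pred t}
  zero_mem' := fun S => ⟨U.unop, S.2, 𝟙 _, PolyPres.const 0, fun S => by
    have := PolyPres.const_presents 0 S.1
    rwa [map_zero] at this⟩
  one_mem' := fun S => ⟨U.unop, S.2, 𝟙 _, PolyPres.const 1, fun S => by
    have := PolyPres.const_presents 1 S.1
    rwa [map_one] at this⟩
  add_mem' := by
    intro a b ha hb S
    obtain ⟨V, hV, i, P, hP⟩ := ha S
    obtain ⟨W, hW, j, Q, hQ⟩ := hb S
    exact ⟨V ⊓ W, ⟨hV, hW⟩, Opens.infLELeft _ _ ≫ i, _, fun T =>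
      PolyPres.add_presents (hP ⟨T.1, T.2.1⟩) (hQ ⟨T.1, T.2.2⟩)⟩
  mul_mem' := by
    intro a b ha hb S
    obtain ⟨V, hV, i, P, hP⟩ := ha S
    obtain ⟨W, hW, j, Q, hQ⟩ := hb S
    exact ⟨V ⊓ W, ⟨hV, hW⟩, Opens.infLELeft _ _ ≫ i, _, fun T =>
      PolyPres.mul_presents (hP ⟨T.1, T.2.1⟩) (hQ ⟨T.1, T.2.2⟩)⟩
  neg_mem' := by
    intro a ha S
    obtain ⟨V, hV, i, P, hP⟩ := ha S
    refine ⟨V, hV, i, (PolyPres.const (-1)).combine P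
      (rename .inl (PolyPres.const (-1)).num * rename .inr P.num), fun T => ?_⟩
    have := PolyPres.mul_presents (PolyPres.const_presents (-1) T.1) (hP T)
    rwa [map_neg, map_one, neg_one_mul] at this

/-- The structure sheaf as a sheaf of sets. -/
def typeSheaf (A : RingCat.{u}) : TopCat.Sheaf (Type u) (top A) :=
  TopCat.subsheafToTypes (isSection A)

instance (A : RingCat.{u}) (U : (Opens (top A))ᵒᵖ) : Ring ((typeSheaf A).1.obj U) :=
  (sections A U).toRing

/-- The structure sheaf `𝒪_A` as a presheaf of rings. -/
def ringPresheaf (A : RingCat.{u}) : TopCat.Presheaf RingCat.{u} (top A) where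
  obj U := RingCat.of ((typeSheaf A).1.obj U)
  map i := RingCat.ofHom
    { toFun := (typeSheaf A).1.map i
      map_zero' := rfl
      map_add' := fun _ _ => rfl
      map_one' := rfl
      map_mul' := fun _ _ => rfl }

theorem ringPresheaf_isSheaf (A : RingCat.{u}) : (ringPresheaf A).IsSheaf :=
  (TopCat.Presheaf.isSheaf_iff_isSheaf_comp (forget RingCat.{u}) _).mpr
    (TopCat.Presheaf.isSheaf_of_iso
      (NatIso.ofComponents (fun _ => Iso.refl _) (by cat_disch) :
        (typeSheaf A).1 ≅ ringPresheaf A ⋙ forget RingCat.{u}) (typeSheaf A).property)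

/-! ### F-schemes -/

/-- Ringed spaces, with sheaves of not necessarily commutative rings. -/
abbrev RSpace : Type (u + 1) := SheafedSpace.{u + 1, u, u} RingCat.{u}

/-- The ringed space `(F(A), 𝒪_A)`. -/
def F (A : RingCat.{u}) : RSpace.{u} where
  carrier := top A
  presheaf := ringPresheaf A
  IsSheaf := ringPresheaf_isSheaf A

/-- The open ringed subspace `(U, 𝒪_X|_U)`. -/
def openSub (X : RSpace.{u}) (U : Opens X) : RSpace.{u} :=
  X.restrict U.isOpenEmbedding

/-- An affine F-scheme is a ringed space isomorphic to `F(A)` for some nonzero ring `A`. -/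
def IsAffineFScheme (X : RSpace.{u}) : Prop :=
  ∃ A : RingCat.{u}, Nontrivial A ∧ Nonempty (X ≅ F A)

/-- An F-scheme is a ringed space which is locally isomorphic to affine F-schemes. -/
def IsFScheme (X : RSpace.{u}) : Prop :=
  ∀ x : X, ∃ U : Opens X, x ∈ U ∧ IsAffineFScheme (openSub X U)

end FSch

end

/-! The proof replaces the explicit sequences of sets by universal properties. Let `𝒮` be the system
of `φ : A → B`. The induced map `A_𝒮 → B` is local, because an element that becomes a unit in `B` is
inverted at the next stage. A local homomorphism does not change the system (`ofHom_comp`), so `𝒮`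
is also the system of `A → A_𝒮` (`ofHom_fromBase`), and `𝐚 ∈ 𝒮` says exactly that `A → A_𝒮` factors
through `A → A_𝐚` (`Fraction.mem_iff`).

Both `A → A_𝐚` and `A → A_𝒮` are epimorphisms. Hence pulling systems back along `A → A_𝐚` is
injective with image `D(𝐚)` and induces isomorphisms of the localizations `A_𝒮`. It is an open
embedding, since a basic open set of `F(A_𝐚)` is the preimage of the one given by a concatenated
fraction.

For the sheaves, a presentation over `A_a` becomes one over `A` by treating `x_a` as a further
variable. This is legitimate because the level conditions on a presentation amount to mere
invertibility in `A_𝒮` (`isAssignment_iff`). So `F(A_𝐚) → F(A)` is an open immersion onto `D(𝐚)`.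
Since the sets `D(𝐚)` form a basis, (2) follows. -/

noncomputable section

namespace FSch

/-! ### Fractions and extensions of homomorphisms -/

namespace Fraction

/-- The canonical homomorphism `A → A_𝐚`. -/
def map : ∀ {A : RingCat.{u}} (a : Fraction A), A →+* a.ring
  | _, .nil _ => RingHom.id _
  | _, .cons a t => t.map.comp (Loc.of {a})

/-- `φ` factors through `A → A_𝐚`. -/
def Extends {A : RingCat.{u}} (a : Fraction A) {B : Type u} [Ring B] (φ : A →+* B) : Prop :=
  ∃ g : a.ring →+* B, g.comp a.map = φ

/-- Each single localization is an epimorphism, hence so is their composite. -/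
theorem hom_ext {A : RingCat.{u}} (a : Fraction A) {B : Type u} [Ring B] {f g : a.ring →+* B}
    (h : f.comp a.map = g.comp a.map) : f = g := by
  induction a with
  | nil A => exact h
  | cons a t ih => exact ih (Loc.hom_ext _ h)

theorem extends_nil {A : RingCat.{u}} {B : Type u} [Ring B] (φ : A →+* B) :
    (nil A).Extends φ := ⟨φ, rfl⟩

theorem extends_cons {A : RingCat.{u}} {a : A} {t : Fraction (RingCat.of (Loc A {a}))}
    {B : Type u} [Ring B] {φ : A →+* B} :
    (cons a t).Extends φ ↔ ∃ h : IsUnit (φ a), t.Extends (B := B)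
      (Loc.lift {a} φ (by rintro _ rfl; exact h)) := by
  constructor
  · rintro ⟨g, rfl⟩
    have h : IsUnit ((g.comp (cons a t).map) a) :=
      (Loc.isUnit_of {a} (Set.mem_singleton a)).map ((show t.ring →+* B from g).comp t.map)
    refine ⟨h, g, Loc.hom_ext _ ?_⟩
    ext x
    exact (Loc.lift_of _ _ _ x).symm
  · rintro ⟨h, g, hg⟩
    refine ⟨g, ?_⟩
    ext x
    exact (RingHom.congr_fun hg (Loc.of {a} x)).trans (Loc.lift_of _ _ _ x)

/-- Extending over `A_𝐚` is a succession of unit conditions, and a local homomorphism reflects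
units. -/
theorem extends_comp_iff {A : RingCat.{u}} (a : Fraction A) {B C : Type u} [Ring B] [Ring C]
    (φ : A →+* B) (ψ : B →+* C) [IsLocalHom ψ] : a.Extends (ψ.comp φ) ↔ a.Extends φ := by
  refine ⟨?_, ?_⟩
  · intro h
    induction a with
    | nil A => exact extends_nil φ
    | cons a t ih =>
      obtain ⟨h, h'⟩ := extends_cons.1 h
      refine extends_cons.2 ⟨isUnit_of_map_unit ψ _ h, ih _ ?_⟩
      convert h' using 1
      refine Loc.hom_ext _ ?_
      ext x
      simp [Loc.lift_of]
  · rintro ⟨g, rfl⟩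
    exact ⟨ψ.comp g, rfl⟩

/-- The image of a fraction under a homomorphism. -/
def push : ∀ {A : RingCat.{u}}, Fraction A → ∀ {A' : RingCat.{u}}, (A →+* A') → Fraction A'
  | _, .nil _, A', _ => .nil A'
  | _, .cons a t, _, f => .cons (f a) (t.push (A' := RingCat.of (Loc _ {f a}))
      (Loc.lift {a} ((Loc.of {f a}).comp f) fun _ hs =>
        Loc.isUnit_of {f a} (congrArg f (Set.mem_singleton_iff.1 hs))))

theorem extends_push {A : RingCat.{u}} (a : Fraction A) {A' : RingCat.{u}} (f : A →+* A')
    {B : Type u} [Ring B] (φ : A' →+* B) : (a.push f).Extends φ ↔ a.Extends (φ.comp f) := by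
  induction a generalizing A' with
  | nil A => exact ⟨fun _ => extends_nil _, fun _ => extends_nil _⟩
  | cons a t ih =>
    refine extends_cons.trans (Iff.trans ?_ extends_cons.symm)
    refine exists_congr fun h => (ih (A' := RingCat.of (Loc _ {f a})) _ _).trans ?_
    refine Eq.to_iff (congrArg _ (Loc.hom_ext _ ?_))
    ext x
    simp [Loc.lift_of]

/-- The concatenation of a fraction of `A` and a fraction of `A_𝐚`. -/
def append : ∀ {A : RingCat.{u}} (a : Fraction A), Fraction a.ring → Fraction A
  | _, .nil _, b => b
  | _, .cons a t, b => .cons a (t.append b)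

theorem extends_append {A : RingCat.{u}} (a : Fraction A) (b : Fraction a.ring)
    {B : Type u} [Ring B] (φ : a.ring →+* B) :
    (a.append b).Extends (φ.comp a.map) ↔ b.Extends φ := by
  induction a with
  | nil A => exact Iff.rfl
  | cons a t ih =>
    refine extends_cons.trans (Iff.trans ?_ (ih b φ))
    have key : ∀ h, Loc.lift {a} (φ.comp (cons a t).map) h =
        (show t.ring →+* B from φ).comp t.map := fun h => Loc.hom_ext _ (by
      ext x
      exact Loc.lift_of _ _ _ x)
    refine ⟨fun ⟨h, h'⟩ => by rwa [key] at h', fun h' => ⟨?_, by rwa [key]⟩⟩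
    exact (Loc.isUnit_of {a} (Set.mem_singleton a)).map ((show t.ring →+* B from φ).comp t.map)

/-- This yields `D(𝐚) ∩ D(𝐛)` as a single fundamental open set. -/
theorem extends_append_push {A : RingCat.{u}} (a b : Fraction A) {B : Type u} [Ring B]
    (φ : A →+* B) : (a.append (b.push a.map)).Extends φ ↔ a.Extends φ ∧ b.Extends φ := by
  constructor
  · intro h
    have ha : a.Extends φ := by
      -- The induction strips entries off `a`, so the second fraction has to be an arbitrary
      -- fraction of `a.ring`, no longer tied to `b`.
      generalize b.push a.map = c at h
      clear b
      induction a with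
      | nil A => exact extends_nil _
      | cons a t ih =>
        obtain ⟨h1, h2⟩ := extends_cons.1 h
        exact extends_cons.2 ⟨h1, ih _ _ h2⟩
    refine ⟨ha, ?_⟩
    obtain ⟨g, rfl⟩ := ha
    exact (extends_push b a.map g).1 ((extends_append a _ g).1 h)
  · rintro ⟨⟨g, rfl⟩, hb⟩
    exact (extends_append a _ g).2 ((extends_push b a.map g).2 hb)

end Fraction

/-! ### The universal property of the localization at a fully invertible system -/

namespace FullSpec

variable {A : RingCat.{u}}

/-- The fully invertible system of a homomorphism to a nonzero ring. -/
def ofHom {B : RingCat.{u}} [Nontrivial B] (φ : A →+* B) : FullSpec A :=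
  ⟨fun n => (succLoc φ n).1, B, ‹_›, φ, fun _ => rfl⟩

theorem exists_eq_ofHom (S : FullSpec A) :
    ∃ (B : RingCat.{u}) (_ : Nontrivial B) (φ : A →+* B), S = ofHom φ := by
  obtain ⟨B, hB, φ, h⟩ := S.exists_hom
  exact ⟨B, hB, φ, FullSpec.ext (funext h)⟩

theorem diagram_map (S : FullSpec A) (n : ℕ) :
    (Functor.ofSequence (X := S.ring) fun n => RingCat.ofHom (S.step n)).map
      (homOfLE (Nat.le_succ n)) = RingCat.ofHom (S.step n) :=
  Functor.ofSequence_map_homOfLE_succ (X := S.ring) (fun n => RingCat.ofHom (S.step n)) n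

theorem toLoc_comp_step (S : FullSpec A) (n : ℕ) :
    (S.toLoc (n + 1)).comp (S.step n) = S.toLoc n := by
  have := colimit.w (Functor.ofSequence (X := S.ring) fun n => RingCat.ofHom (S.step n))
    (homOfLE (Nat.le_succ n))
  exact congrArg RingCat.Hom.hom
    ((congrArg (· ≫ colimit.ι _ _) (S.diagram_map n)).symm.trans this)

theorem toLoc_step (S : FullSpec A) (n : ℕ) (x : S.ring n) :
    S.toLoc (n + 1) (S.step n x) = S.toLoc n x :=
  RingHom.congr_fun (S.toLoc_comp_step n) x

theorem exists_toLoc (S : FullSpec A) (y : S.loc) : ∃ n x, S.toLoc n x = y :=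
  -- The index category `ℕ` lives in universe `0`, so preservation of filtered colimits is lowered
  -- to that size.
  have := preservesFilteredColimitsOfSize_shrink.{0, u, 0, u} (forget RingCat.{u})
  Concrete.colimit_exists_rep
    (Functor.ofSequence (X := S.ring) fun n => RingCat.ofHom (S.step n)) y

theorem range_toLoc_mono (S : FullSpec A) {m n : ℕ} (h : m ≤ n) :
    (S.toLoc m).range ≤ (S.toLoc n).range := by
  induction n, h using Nat.le_induction with
  | base => exact le_rfl
  | succ n _ ih =>
    refine ih.trans ?_
    rintro _ ⟨x, rfl⟩
    exact ⟨S.step n x, S.toLoc_step n x⟩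

/-- `A → A_𝒮` is an epimorphism, as a direct limit of successive localizations. -/
theorem loc_hom_ext (S : FullSpec A) {B : Type u} [Ring B] {f g : S.loc →+* B}
    (h : f.comp S.fromBase = g.comp S.fromBase) : f = g := by
  have key : ∀ n, f.comp (S.toLoc n) = g.comp (S.toLoc n) := by
    -- For a system of the form `ofHom φ` the chains extend one another definitionally, so `step` is
    -- `Loc.of` without a transport.
    obtain ⟨C, _, φ, rfl⟩ := S.exists_eq_ofHom
    intro n
    induction n with
    | zero => exact h
    | succ n ih =>
      refine Loc.hom_ext _ ?_
      rw [← toLoc_comp_step] at ih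
      exact ih
  ext y
  obtain ⟨n, x, rfl⟩ := S.exists_toLoc y
  exact RingHom.congr_fun (key n) x

/-- The local homomorphism `A_𝒮 → B` for the fully invertible system `𝒮` of `φ : A → B`. -/
def ofHomLift {B : RingCat.{u}} [Nontrivial B] (φ : A →+* B) : (ofHom φ).loc →+* B :=
  (colimit.desc (Functor.ofSequence (X := (ofHom φ).ring) fun n => RingCat.ofHom ((ofHom φ).step n))
    ⟨B, NatTrans.ofSequence (fun n => RingCat.ofHom (succLoc φ n).2) (fun n => by
      refine (congrArg (· ≫ _) ((ofHom φ).diagram_map n)).trans (RingCat.hom_ext ?_)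
      ext x
      exact Loc.lift_of _ (succLoc φ n).2 (fun _ h => h) x)⟩).hom

theorem ofHomLift_toLoc {B : RingCat.{u}} [Nontrivial B] (φ : A →+* B) (n : ℕ)
    (x : (ofHom φ).ring n) : ofHomLift φ ((ofHom φ).toLoc n x) = (succLoc φ n).2 x :=
  RingHom.congr_fun (congrArg RingCat.Hom.hom (colimit.ι_desc (F := Functor.ofSequence
    (X := (ofHom φ).ring) fun n => RingCat.ofHom ((ofHom φ).step n)) _ n)) x

theorem ofHomLift_comp_fromBase {B : RingCat.{u}} [Nontrivial B] (φ : A →+* B) :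
    (ofHomLift φ).comp (ofHom φ).fromBase = φ := by
  ext x
  exact ofHomLift_toLoc φ 0 x

/-- An element of `A_𝒮` comes from some `A_{𝒮,n}`. If its image in `B` is a unit, it lies in
`S_{n+1}` by definition and is inverted in `A_{𝒮,n+1}`. -/
instance isLocalHom_ofHomLift {B : RingCat.{u}} [Nontrivial B] (φ : A →+* B) :
    IsLocalHom (ofHomLift φ) where
  map_nonunit y hy := by
    obtain ⟨n, x, rfl⟩ := (ofHom φ).exists_toLoc y
    rw [ofHomLift_toLoc] at hy
    have := (ofHom φ).isUnit_step (n := n) (x := x) hy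
    rw [← toLoc_step]
    exact this.map _

/-- A unit of `A_𝒮` stays a unit in any `B` that defines `𝒮`. Thus the sets of a system can be read
off from `A_𝒮`, without reference to `B`. -/
theorem mem_set_iff (S : FullSpec A) {n : ℕ} {x : S.ring n} :
    x ∈ S.set n ↔ IsUnit (S.toLoc n x) := by
  constructor
  · intro h
    rw [← toLoc_step]
    exact (S.isUnit_step h).map _
  · obtain ⟨B, _, φ, rfl⟩ := S.exists_eq_ofHom
    intro h
    have := h.map (ofHomLift φ)
    rw [ofHomLift_toLoc] at this
    exact this

instance (S : FullSpec A) : Nontrivial S.loc := by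
  obtain ⟨B, _, φ, rfl⟩ := S.exists_eq_ofHom
  exact (ofHomLift φ).domain_nontrivial

/-- Units of `C` and units of `B` have the same preimage at every stage, because `ψ` is local. -/
theorem succLoc_comp {B C : RingCat.{u}} (φ : A →+* B) (ψ : B →+* C) [IsLocalHom ψ] (n : ℕ) :
    succLoc (ψ.comp φ) n = ⟨(succLoc φ n).1, ψ.comp (succLoc φ n).2⟩ := by
  induction n with
  | zero => rfl
  | succ n ih =>
    -- `G` is the recursion step of `succLoc`; the inductive hypothesis, an equality of dependent
    -- pairs, is carried through it by congruence.
    let G : (Σ p : Chain A n, (p.ring →+* C)) → Σ p : Chain A (n + 1), (p.ring →+* C) :=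
      fun q => ⟨⟨q.1, {x | IsUnit (q.2 x)}⟩, Loc.lift _ q.2 fun _ h => h⟩
    refine (congrArg G ih).trans ?_
    -- The two sets of inverted elements are only propositionally equal, so the equality of pairs is
    -- proved for arbitrary equal sets.
    have key : ∀ (T T' : Set (succLoc φ n).1.ring) (_ : T = T')
        (f : Loc (succLoc φ n).1.ring T →+* C) (g : Loc (succLoc φ n).1.ring T' →+* C)
        (_ : f.comp (Loc.of T) = g.comp (Loc.of T')),
        (⟨⟨(succLoc φ n).1, T⟩, f⟩ : Σ p : Chain A (n + 1), (p.ring →+* C)) =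
          ⟨⟨(succLoc φ n).1, T'⟩, g⟩ := by
      rintro T _ rfl f g h
      rw [Loc.hom_ext T h]
    refine key _ _ (Set.ext fun x => isUnit_map_iff ψ _) _ _ ?_
    ext x
    exact (Loc.lift_of _ _ _ x).trans
      (congrArg ψ (Loc.lift_of _ (succLoc φ n).2 (fun _ h => h) x).symm)

theorem ofHom_comp {B C : RingCat.{u}} [Nontrivial B] [Nontrivial C] (φ : A →+* B) (ψ : B →+* C)
    [IsLocalHom ψ] : ofHom (ψ.comp φ) = ofHom φ :=
  FullSpec.ext (funext fun n => congrArg Sigma.fst (succLoc_comp φ ψ n))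

/-- If `φ` defines `𝒮`, it is `A → A_𝒮` followed by a local homomorphism, so both define the same
system. -/
theorem ofHom_fromBase (S : FullSpec A) : ofHom S.fromBase = S := by
  obtain ⟨B, _, φ, rfl⟩ := S.exists_eq_ofHom
  have := ofHom_comp (ofHom φ).fromBase (ofHomLift φ)
  simp only [ofHomLift_comp_fromBase] at this
  exact this.symm

theorem exists_of_ofHom_eq {B : RingCat.{u}} [Nontrivial B] {φ : A →+* B} {S : FullSpec A}
    (h : ofHom φ = S) : ∃ ψ : S.loc →+* B, ψ.comp S.fromBase = φ := by
  subst h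
  exact ⟨_, ofHomLift_comp_fromBase φ⟩

end FullSpec

/-! ### Membership of fractions -/

/-- By `mem_set_iff` every membership condition is invertibility in `A_𝒮`, which is what the next
extension needs. -/
theorem Fraction.memAux_iff {A : RingCat.{u}} (S : FullSpec A) {R : RingCat.{u}} (a : Fraction R)
    (k : ℕ) (f : R →+* S.ring k) : a.MemAux S k f ↔ a.Extends ((S.toLoc k).comp f) := by
  induction a generalizing k with
  | nil A => exact ⟨fun _ => extends_nil _, fun _ => trivial⟩
  | cons a t ih =>
    refine Iff.trans ?_ extends_cons.symm
    have key : ∀ h h', (S.toLoc (k + 1)).comp (Loc.lift {a} ((S.step k).comp f) h) =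
        Loc.lift {a} ((S.toLoc k).comp f) h' := fun h h' => Loc.hom_ext _ (by
      ext x
      simp [Loc.lift_of, FullSpec.toLoc_step])
    constructor
    · rintro ⟨h, h'⟩
      refine ⟨S.mem_set_iff.1 h, ?_⟩
      have := (ih _ _).1 h'
      rwa [key] at this
    · rintro ⟨h, h'⟩
      refine ⟨S.mem_set_iff.2 h, (ih _ _).2 ?_⟩
      rwa [key]

theorem Fraction.mem_iff {A : RingCat.{u}} (a : Fraction A) (S : FullSpec A) :
    a.Mem S ↔ a.Extends S.fromBase :=
  a.memAux_iff S 0 (RingHom.id A)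

theorem Fraction.mem_ofHom_iff {A B : RingCat.{u}} [Nontrivial B] (a : Fraction A) (φ : A →+* B) :
    a.Mem (FullSpec.ofHom φ) ↔ a.Extends φ := by
  rw [mem_iff, ← extends_comp_iff a _ (FullSpec.ofHomLift φ), FullSpec.ofHomLift_comp_fromBase]

theorem isTopologicalBasis_D (A : RingCat.{u}) :
    IsTopologicalBasis (Set.range fun a : Fraction A => {S : FullSpec A | a.Mem S}) := by
  have h := isTopologicalBasis_of_subbasis_of_inter
    (r := Set.range fun a : Fraction A => {S : FullSpec A | a.Mem S}) rfl (by
      rintro _ ⟨a, rfl⟩ _ ⟨b, rfl⟩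
      refine ⟨a.append (b.push a.map), Set.ext fun S => ?_⟩
      exact (Fraction.mem_iff _ _).trans ((Fraction.extends_append_push a b _).trans
        (and_congr (a.mem_iff S).symm (b.mem_iff S).symm)))
  -- The whole space, which a subbasis closed under binary intersections may lack, is `D` of the
  -- empty fraction.
  rwa [Set.insert_eq_of_mem] at h
  exact ⟨.nil A, Set.eq_univ_of_forall fun S => trivial⟩

/-! ### Functoriality of the full spectrum -/

namespace FullSpec

variable {A A' : RingCat.{u}}

/-- The map `F(A') → F(A)` induced by a homomorphism `A → A'`. -/
def pullback (f : A →+* A') (S : FullSpec A') : FullSpec A :=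
  ofHom (S.fromBase.comp f)

/-- The homomorphism `A_𝒮 → A'_𝒮'`, for `𝒮` the inverse image of `𝒮'`. -/
def locMap (f : A →+* A') (S : FullSpec A') : (S.pullback f).loc →+* S.loc :=
  ofHomLift (S.fromBase.comp f)

instance (f : A →+* A') (S : FullSpec A') : IsLocalHom (S.locMap f) :=
  isLocalHom_ofHomLift _

theorem locMap_comp_fromBase (f : A →+* A') (S : FullSpec A') :
    (S.locMap f).comp (S.pullback f).fromBase = S.fromBase.comp f :=
  ofHomLift_comp_fromBase _

theorem mem_pullback_iff (f : A →+* A') (S : FullSpec A') (a : Fraction A) :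
    a.Mem (S.pullback f) ↔ (a.push f).Mem S := by
  rw [pullback, Fraction.mem_ofHom_iff, Fraction.mem_iff, Fraction.extends_push]

theorem continuous_pullback (f : A →+* A') : Continuous (pullback f) := by
  refine continuous_generateFrom_iff.2 ?_
  rintro _ ⟨a, rfl⟩
  simp only [Set.preimage_ofPred_eq, mem_pullback_iff]
  exact (D (a.push f)).isOpen

variable (a : Fraction A)

/-- This recovers `S'` from its pullback `S`. Locality of `A_S → (A_𝐚)_{S'}` lets `A → A_S` extend
to `g : A_𝐚 → A_S`. Followed by that local map, `g` is the canonical map of `S'`, so `g` defines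
`S'`. -/
theorem exists_ofHom_of_pullback_eq {S : FullSpec A} {S' : FullSpec a.ring}
    (h : S'.pullback a.map = S) : ∃ g : a.ring →+* S.loc, g.comp a.map = S.fromBase ∧
      ofHom g = S' := by
  subst h
  have hm : a.Extends (S'.pullback a.map).fromBase := by
    rw [← Fraction.extends_comp_iff a _ (S'.locMap a.map), locMap_comp_fromBase]
    exact ⟨_, rfl⟩
  obtain ⟨g, hg⟩ := hm
  refine ⟨g, hg, ?_⟩
  have : (S'.locMap a.map).comp g = S'.fromBase := a.hom_ext (by
    rw [RingHom.comp_assoc, hg, locMap_comp_fromBase])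
  rw [← ofHom_comp g (S'.locMap a.map)]
  simp only [this, ofHom_fromBase]

/-- The extension `g` is determined by `S`, since `A → A_𝐚` is an epimorphism, and `g` determines
`S'`. -/
theorem pullback_map_injective : Function.Injective (pullback a.map) := by
  intro S S' h
  obtain ⟨g, hg, rfl⟩ := exists_ofHom_of_pullback_eq a h
  obtain ⟨g', hg', hS'⟩ := exists_ofHom_of_pullback_eq a (Eq.refl (S'.pullback a.map))
  refine Eq.trans ?_ hS'
  simp only [a.hom_ext (hg.trans hg'.symm)]

/-- Since `g : A_𝐚 → A_𝒮` defines the system upstairs, it induces a map opposite to `locMap`. The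
two are mutually inverse because the canonical maps are epimorphisms. -/
theorem locMap_map_bijective (S : FullSpec a.ring) : Function.Bijective (S.locMap a.map) := by
  obtain ⟨g, hg, hS⟩ := exists_ofHom_of_pullback_eq a (S' := S) rfl
  obtain ⟨h, hh⟩ := exists_of_ofHom_eq hS
  have h1 : (S.locMap a.map).comp h = RingHom.id _ := S.loc_hom_ext (a.hom_ext (by
    rw [RingHom.comp_assoc _ h, hh, RingHom.comp_assoc, hg, locMap_comp_fromBase, RingHom.id_comp]))
  have h2 : h.comp (S.locMap a.map) = RingHom.id _ := (S.pullback a.map).loc_hom_ext (by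
    rw [RingHom.comp_assoc, locMap_comp_fromBase, ← RingHom.comp_assoc, hh, hg, RingHom.id_comp])
  exact ⟨Function.LeftInverse.injective (RingHom.congr_fun h2),
    Function.RightInverse.surjective (RingHom.congr_fun h1)⟩

theorem range_pullback_map : Set.range (pullback a.map) = {S | a.Mem S} := by
  ext S
  constructor
  · rintro ⟨S', rfl⟩
    exact (Fraction.mem_ofHom_iff a _).2 ⟨_, rfl⟩
  · intro h
    obtain ⟨g, hg⟩ := (a.mem_iff S).1 h
    -- The preimage of `S` is the system of the extension `g : A_𝐚 → A_𝒮` of the canonical map.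
    refine ⟨ofHom g, ?_⟩
    rw [pullback, ← ofHom_comp _ (ofHomLift g)]
    simp only [← RingHom.comp_assoc, ofHomLift_comp_fromBase, hg, ofHom_fromBase]

theorem mem_append_pullback_iff (b : Fraction a.ring) (S : FullSpec a.ring) :
    (a.append b).Mem (S.pullback a.map) ↔ b.Mem S := by
  rw [pullback, Fraction.mem_ofHom_iff, Fraction.extends_append, Fraction.mem_iff]

theorem isOpenEmbedding_pullback_map : Topology.IsOpenEmbedding (pullback a.map) where
  eq_induced := by
    refine le_antisymm (continuous_pullback a.map).le_induced ?_
    refine le_generateFrom ?_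
    rintro _ ⟨b, rfl⟩
    refine isOpen_induced_iff.2 ⟨_, (D (a.append b)).isOpen, ?_⟩
    ext S
    exact mem_append_pullback_iff a b S
  injective := pullback_map_injective a
  isOpen_range := by
    rw [range_pullback_map]
    exact (D a).isOpen

end FullSpec

/-! ### Polynomial presentations along a homomorphism -/

/-- The value of a noncommutative polynomial in elements of `A` and variables `I`. -/
def evalHom {A : RingCat.{u}} {B : Type u} [Ring B] (φ : A →+* B) {I : Type} (x : I → B) :
    FreeAlgebra ℤ (A ⊕ I) →ₐ[ℤ] B :=
  FreeAlgebra.lift ℤ (Sum.elim φ x)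

theorem evalHom_comp {A : RingCat.{u}} {B C : Type u} [Ring B] [Ring C] (φ : A →+* B)
    (ψ : B →+* C) {I : Type} (x : I → B) (p : FreeAlgebra ℤ (A ⊕ I)) :
    evalHom (ψ.comp φ) (ψ ∘ x) p = ψ (evalHom φ x p) := by
  have : evalHom (ψ.comp φ) (ψ ∘ x) = ψ.toIntAlgHom.comp (evalHom φ x) := by
    refine FreeAlgebra.hom_ext ?_
    funext z
    rcases z with a | i <;> simp [evalHom]
  exact DFunLike.congr_fun this p

theorem evalHom_mem {A : RingCat.{u}} {B : Type u} [Ring B] (φ : A →+* B) {I : Type} (x : I → B)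
    {R : Subring B} (hφ : ∀ a, φ a ∈ R) (hx : ∀ i, x i ∈ R) (p : FreeAlgebra ℤ (A ⊕ I)) :
    evalHom φ x p ∈ R := by
  have := evalHom_comp (φ.codRestrict R hφ) R.subtype (fun i => ⟨x i, hx i⟩) p
  refine (congrArg (· ∈ R) this).mpr (SetLike.coe_mem _)

namespace PolyPres

variable {A A' : RingCat.{u}} {B C : Type u} [Ring B] [Ring C]

/-- The variables of `P` are inverses in `B` of the denominators of `P`. -/
def IsAssignmentHom (P : PolyPres A) (φ : A →+* B) (x : P.Idx → B) : Prop :=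
  ∀ j : P.Idx,
    x j * evalHom φ (fun i : {i : P.Idx // P.level i < P.level j} => x i.1) (P.den j) = 1 ∧
    evalHom φ (fun i : {i : P.Idx // P.level i < P.level j} => x i.1) (P.den j) * x j = 1

/-- `P` presents the element `y` of `B` along `φ : A → B`. -/
def PresentsHom (P : PolyPres A) (φ : A →+* B) (y : B) : Prop :=
  ∃ x : P.Idx → B, P.IsAssignmentHom φ x ∧ y = evalHom φ x P.num

theorem PresentsHom.comp {P : PolyPres A} {φ : A →+* B} {y : B} (h : P.PresentsHom φ y)
    (ψ : B →+* C) : P.PresentsHom (ψ.comp φ) (ψ y) := by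
  obtain ⟨x, hx, rfl⟩ := h
  refine ⟨ψ ∘ x, fun j => ?_, (evalHom_comp φ ψ x _).symm⟩
  have := evalHom_comp φ ψ (fun i : {i : P.Idx // P.level i < P.level j} => x i.1) (P.den j)
  obtain ⟨h1, h2⟩ := hx j
  constructor
  · refine (congrArg (ψ (x j) * ·) this).trans ?_
    rw [← map_mul, h1, map_one]
  · refine (congrArg (· * ψ (x j)) this).trans ?_
    rw [← map_mul, h2, map_one]

/-- The requirement `s_j ∈ S_{n+1}` is automatic once `x_j` is inverse to the value of `den j` in
`A_𝒮`. By induction on the level, that value comes from some `s` in `A_{𝒮,n}`, and `s` lies in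
`S_{n+1}` because it is invertible in `A_𝒮`. Presentations can then be moved along arbitrary
homomorphisms. -/
theorem isAssignment_iff (P : PolyPres A) (S : FullSpec A) (x : P.Idx → S.loc) :
    P.IsAssignment S x ↔ P.IsAssignmentHom S.fromBase x := by
  constructor
  · intro h j
    obtain ⟨s, hs, h1, h2⟩ := h j
    rw [h1] at h2
    exact h2
  · intro h
    have step : ∀ j, (∀ i, P.level i < P.level j → x i ∈ (S.toLoc (P.level j)).range) →
        ∃ s ∈ S.set (P.level j), S.toLoc _ s =
          evalAt S (fun i : {i : P.Idx // P.level i < P.level j} => x i.1) (P.den j) := by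
      intro j hj
      obtain ⟨s, hs⟩ := evalHom_mem S.fromBase
        (fun i : {i : P.Idx // P.level i < P.level j} => x i.1)
        (R := (S.toLoc (P.level j)).range)
        (fun a => S.range_toLoc_mono (Nat.zero_le _) ⟨a, rfl⟩) (fun i => hj i.1 i.2) (P.den j)
      refine ⟨s, S.mem_set_iff.2 ?_, hs⟩
      rw [hs]
      exact ⟨⟨_, x j, (h j).2, (h j).1⟩, rfl⟩
    -- The inequality is strict because an element of `S_{n+1} ⊆ A_{𝒮,n}` acquires its inverse only
    -- in `A_{𝒮,n+1}`.
    have mem : ∀ n j, P.level j < n → x j ∈ (S.toLoc n).range := by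
      intro n
      induction n with
      | zero => exact fun j hj => absurd hj (Nat.not_lt_zero _)
      | succ n ih =>
        intro j hj
        have hjn : P.level j ≤ n := Nat.lt_succ_iff.1 hj
        obtain hlt | heq := hjn.lt_or_eq
        · exact S.range_toLoc_mono (Nat.le_succ n) (ih j hlt)
        · subst heq
          obtain ⟨s, hs, hse⟩ := step j ih
          obtain ⟨u, hu⟩ := S.isUnit_step hs
          refine ⟨(u⁻¹).1, ?_⟩
          refine left_inv_eq_right_inv (a := S.toLoc _ s) ?_ (hse ▸ (h j).2)
          rw [← S.toLoc_step _ s, ← hu, ← map_mul, Units.inv_mul, map_one]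
    intro j
    obtain ⟨s, hs, hse⟩ := step j (mem _)
    refine ⟨s, hs, hse, ?_⟩
    rw [hse]
    exact h j

theorem presents_iff (P : PolyPres A) (S : FullSpec A) (y : S.loc) :
    P.Presents S y ↔ P.PresentsHom S.fromBase y :=
  exists_congr fun x => and_congr (P.isAssignment_iff S x) Iff.rfl

/-- Replacing the coefficients of a polynomial by polynomials. -/
def subst {I J : Type} (q : A' → FreeAlgebra ℤ (A ⊕ J)) (g : I → J) :
    FreeAlgebra ℤ (A' ⊕ I) →ₐ[ℤ] FreeAlgebra ℤ (A ⊕ J) :=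
  FreeAlgebra.lift ℤ (Sum.elim q fun i => FreeAlgebra.ι ℤ (Sum.inr (g i)))

theorem evalHom_subst {I J : Type} (q : A' → FreeAlgebra ℤ (A ⊕ J)) (g : I → J) (φ : A →+* B)
    (φ' : A' →+* B) (x : J → B) (h : ∀ a, evalHom φ x (q a) = φ' a)
    (p : FreeAlgebra ℤ (A' ⊕ I)) : evalHom φ x (subst q g p) = evalHom φ' (x ∘ g) p := by
  have : (evalHom φ x).comp (subst q g) = evalHom φ' (x ∘ g) := by
    refine FreeAlgebra.hom_ext ?_
    funext z
    rcases z with a | i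
    · simp [evalHom, subst] at h ⊢
      exact h a
    · simp [evalHom, subst]
  exact DFunLike.congr_fun this p

/-- The image of a presentation under a homomorphism. -/
def push (P : PolyPres A) (f : A →+* A') : PolyPres A' where
  Idx := P.Idx
  finite := P.finite
  level := P.level
  den j := subst (fun a => FreeAlgebra.ι ℤ (Sum.inl (f a))) id (P.den j)
  num := subst (fun a => FreeAlgebra.ι ℤ (Sum.inl (f a))) id P.num

theorem PresentsHom.push {P : PolyPres A} {f : A →+* A'} {φ : A' →+* B} {y : B}
    (h : P.PresentsHom (φ.comp f) y) : (P.push f).PresentsHom φ y := by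
  have key : ∀ {I : Type} (x : I → B) (p : FreeAlgebra ℤ (A ⊕ I)),
      evalHom φ x (subst (fun a => FreeAlgebra.ι ℤ (Sum.inl (f a))) id p) =
        evalHom (φ.comp f) x p := fun x p => evalHom_subst _ _ _ _ _ (by simp [evalHom]) _
  obtain ⟨x, hx, rfl⟩ := h
  refine ⟨x, fun j => ?_, (key x _).symm⟩
  have := hx j
  rw [← key] at this
  exact this

/-- An expression of an element of `A_a` as a polynomial in elements of `A` and `x_a`. -/
def locPoly {J : Type} (a : A) (j : J) (y : Loc A {a}) : FreeAlgebra ℤ (A ⊕ J) :=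
  FreeAlgebra.lift ℤ (Sum.elim (fun b => FreeAlgebra.ι ℤ (Sum.inl b))
    fun _ => FreeAlgebra.ι ℤ (Sum.inr j)) (RingQuot.mkRingHom_surjective (LocRel A {a}) y).choose

/-- The arbitrary choice of a preimage in the free ring is harmless: with the new variable evaluated
at `φ(x_a)`, evaluation is `φ` after the quotient map. -/
theorem evalHom_locPoly {J : Type} (a : A) (j : J) (φ : Loc A {a} →+* B) (x : J → B)
    (hx : x j = φ (Loc.inv {a} ⟨a, rfl⟩)) (y : Loc A {a}) :
    evalHom (φ.comp (Loc.of {a})) x (locPoly a j y) = φ y := by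
  have : (evalHom (φ.comp (Loc.of {a})) x).comp
      (FreeAlgebra.lift ℤ (Sum.elim (fun b => FreeAlgebra.ι ℤ (Sum.inl b))
        fun _ : ({a} : Set A) => FreeAlgebra.ι ℤ (Sum.inr j))) =
      (φ.comp (Loc.mk {a})).toIntAlgHom := by
    refine FreeAlgebra.hom_ext ?_
    funext z
    rcases z with b | ⟨_, rfl⟩
    · simp [evalHom]
      rfl
    · simp [evalHom, hx]
      rfl
  refine (DFunLike.congr_fun this _).trans (congrArg φ ?_)
  exact (RingQuot.mkRingHom_surjective (LocRel A {a}) y).choose_spec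

/-- A presentation over `A_a`, rewritten as a presentation over `A` with the additional variable
`x_a`. -/
def ofLoc (a : A) (P : PolyPres (RingCat.of (Loc A {a}))) : PolyPres A where
  Idx := Option P.Idx
  finite := by
    have := P.finite
    infer_instance
  -- `x_a` takes level `0`; shifting the other levels by one makes it available in every other
  -- denominator.
  level j := j.elim 0 fun j => P.level j + 1
  den
    | none => FreeAlgebra.ι ℤ (Sum.inl a)
    | some j => subst (locPoly a ⟨none, Nat.succ_pos _⟩)
        (fun i => ⟨some i.1, Nat.succ_lt_succ i.2⟩) (P.den j)
  num := subst (locPoly a none) some P.num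

theorem PresentsHom.ofLoc {a : A} {P : PolyPres (RingCat.of (Loc A {a}))}
    {φ : Loc A {a} →+* B} {y : B}
    (h : P.PresentsHom (A := RingCat.of (Loc A {a})) φ y) :
    (PolyPres.ofLoc a P).PresentsHom (φ.comp (Loc.of {a})) y := by
  obtain ⟨x, hx, rfl⟩ := h
  let x' : Option P.Idx → B := fun j => j.elim (φ (Loc.inv {a} ⟨a, rfl⟩)) x
  refine ⟨x', ?_, ?_⟩
  · rintro (_ | j)
    · have : ∀ {I : Type} (z : I → B), evalHom (φ.comp (Loc.of {a})) z
          (FreeAlgebra.ι ℤ (Sum.inl a)) = φ (Loc.of {a} a) := by simp [evalHom]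
      refine (and_congr (Eq.congr_left (congrArg (_ * ·) (this _)))
        (Eq.congr_left (congrArg (· * _) (this _)))).2 ⟨?_, ?_⟩
      · exact (map_mul φ _ _).symm.trans
          ((congrArg φ (Loc.inv_mul {a} ⟨a, rfl⟩)).trans (map_one φ))
      · exact (map_mul φ _ _).symm.trans
          ((congrArg φ (Loc.mul_inv {a} ⟨a, rfl⟩)).trans (map_one φ))
    · have := evalHom_subst (A' := RingCat.of (Loc A {a}))
        (J := {i : Option P.Idx // i.elim 0 (fun j => P.level j + 1) < P.level j + 1})
        (locPoly a ⟨none, Nat.succ_pos _⟩)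
        (fun i : {i : P.Idx // P.level i < P.level j} => ⟨some i.1, Nat.succ_lt_succ i.2⟩)
        (φ.comp (Loc.of {a})) φ (fun i => x' i.1) (evalHom_locPoly a _ φ _ rfl) (P.den j)
      exact (and_congr (Eq.congr_left (congrArg (_ * ·) this))
        (Eq.congr_left (congrArg (· * _) this))).2 (hx j)
  · exact (evalHom_subst (A' := RingCat.of (Loc A {a})) _ some _ φ x'
      (evalHom_locPoly a none φ x' rfl) P.num).symm

/-- `Q` is chosen before `φ` and `y`: a single presentation has to serve all points of an open set.
-/
theorem exists_presentsHom_map {A : RingCat.{u}} (a : Fraction A) (P : PolyPres a.ring) :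
    ∃ Q : PolyPres A, ∀ {B : Type u} [Ring B] (φ : a.ring →+* B) (y : B),
      P.PresentsHom φ y → Q.PresentsHom (φ.comp a.map) y := by
  induction a with
  | nil A => exact ⟨P, fun φ y h => h⟩
  | cons a t ih =>
    obtain ⟨Q, hQ⟩ := ih P
    exact ⟨ofLoc a Q, fun φ y h => (hQ φ y h).ofLoc⟩

theorem Presents.push {P : PolyPres A} {f : A →+* A'} {S : FullSpec A'}
    {y : (S.pullback f).loc} (h : P.Presents (S.pullback f) y) :
    (P.push f).Presents S (S.locMap f y) := by
  rw [presents_iff] at h ⊢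
  have := h.comp (S.locMap f)
  rw [FullSpec.locMap_comp_fromBase] at this
  exact this.push

theorem exists_presents_pullback_map (a : Fraction A) (P : PolyPres a.ring) :
    ∃ Q : PolyPres A, ∀ (S : FullSpec a.ring) (y : (S.pullback a.map).loc),
      P.Presents S (S.locMap a.map y) → Q.Presents (S.pullback a.map) y := by
  obtain ⟨Q, hQ⟩ := exists_presentsHom_map a P
  refine ⟨Q, fun S y h => ?_⟩
  rw [presents_iff] at h ⊢
  have h1 := hQ _ _ h
  -- `Q` so far presents the element in the localization of `A_𝐚`; the inverse of `locMap` brings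
  -- this back to `A_𝒮`.
  let e := RingEquiv.ofBijective _ (FullSpec.locMap_map_bijective a S)
  have h2 := h1.comp e.symm.toRingHom
  have h3 : e.symm.toRingHom (S.locMap a.map y) = y := e.symm_apply_apply y
  have h4 : e.symm.toRingHom.comp (S.fromBase.comp a.map) = (S.pullback a.map).fromBase := by
    rw [← FullSpec.locMap_comp_fromBase]
    ext z
    exact e.symm_apply_apply _
  rwa [h3, h4] at h2

end PolyPres

/-! ### The open immersion `F(A_𝐚) → F(A)` -/

/-- The continuous map `F(A') → F(A)` induced by a homomorphism `A → A'`. -/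
def topMap {A A' : RingCat.{u}} (f : A →+* A') : top A' ⟶ top A :=
  TopCat.ofHom ⟨FullSpec.pullback f, FullSpec.continuous_pullback f⟩

/-- The inverse image of sections of the structure sheaf. -/
def sectionsMap {A A' : RingCat.{u}} (f : A →+* A') (U : (Opens (top A))ᵒᵖ) :
    sections A U →+* sections A' ((Opens.map (topMap f)).op.obj U) where
  toFun t := ⟨fun S => S.1.locMap f (t.1 ⟨S.1.pullback f, S.2⟩), fun S => by
    obtain ⟨V, hV, i, P, hP⟩ := t.2 ⟨S.1.pullback f, S.2⟩
    exact ⟨(Opens.map (topMap f)).obj V, hV, (Opens.map (topMap f)).map i, P.push f,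
      fun T => (hP ⟨T.1.pullback f, T.2⟩).push⟩⟩
  map_zero' := Subtype.ext (funext fun S => map_zero (S.1.locMap f))
  map_one' := Subtype.ext (funext fun S => map_one (S.1.locMap f))
  map_add' _ _ := Subtype.ext (funext fun S => map_add (S.1.locMap f) _ _)
  map_mul' _ _ := Subtype.ext (funext fun S => map_mul (S.1.locMap f) _ _)

/-- The comorphism of `F(A') → F(A)`. -/
def presheafMap {A A' : RingCat.{u}} (f : A →+* A') :
    ringPresheaf A ⟶ (TopCat.Presheaf.pushforward RingCat.{u} (topMap f)).obj (ringPresheaf A') where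
  app U := RingCat.ofHom (sectionsMap f U)
  naturality := fun _ _ _ => rfl

/-- The morphism `F(A') → F(A)` induced by a homomorphism `A → A'`. -/
def F.map {A A' : RingCat.{u}} (f : A →+* A') : F A' ⟶ F A :=
  ⟨{ base := topMap f
     c := presheafMap f }⟩

/-- Used to reindex a family of values by systems on `A` instead of systems on `A_𝐚`, where the ring
of values varies with the point. -/
theorem exists_dependent_extension {α β : Type*} {p : α → β} (hp : Function.Bijective p)
    {γ : β → Type*} (w : ∀ x, γ (p x)) : ∃ t : ∀ y, γ y, ∀ x, t (p x) = w x :=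
  ⟨Equiv.piCongrLeft γ (Equiv.ofBijective p hp) w,
    Equiv.piCongrLeft_apply_apply γ (Equiv.ofBijective p hp) w⟩

theorem sectionsMap_bijective {A : RingCat.{u}} (a : Fraction A) (U : Opens (top A))
    (hU : (U : Set (FullSpec A)) ⊆ Set.range (FullSpec.pullback a.map)) :
    Function.Bijective (sectionsMap a.map (op U)) := by
  constructor
  · intro t t' h
    refine Subtype.ext (funext fun S => ?_)
    obtain ⟨S, hS⟩ := S
    obtain ⟨S', rfl⟩ := hU hS
    exact (FullSpec.locMap_map_bijective a S').1 (congrFun (congrArg Subtype.val h) ⟨S', hS⟩)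
  · intro t'
    let p : (Opens.map (topMap a.map)).obj U → U := fun S => ⟨S.1.pullback a.map, S.2⟩
    have hp : Function.Bijective p := by
      refine ⟨fun S T h => Subtype.ext
        (FullSpec.pullback_map_injective a (congrArg Subtype.val h)), ?_⟩
      rintro ⟨S, hS⟩
      obtain ⟨S', rfl⟩ := hU hS
      exact ⟨⟨S', hS⟩, rfl⟩
    choose w hw using fun S : (Opens.map (topMap a.map)).obj U =>
      (FullSpec.locMap_map_bijective a S.1).2 (t'.1 S)
    obtain ⟨t, ht⟩ := exists_dependent_extension hp (γ := fun S : U => S.1.loc) w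
    refine ⟨⟨t, ?_⟩, Subtype.ext (funext fun S => ?_)⟩
    · intro S
      obtain ⟨S, rfl⟩ := hp.2 S
      obtain ⟨V, hV, i, P, hP⟩ := t'.2 S
      obtain ⟨Q, hQ⟩ := PolyPres.exists_presents_pullback_map a P
      -- The image of `V` is open because the pullback is an open embedding, and on it the rewritten
      -- presentation `Q` gives the section.
      refine ⟨⟨FullSpec.pullback a.map '' V,
        (FullSpec.isOpenEmbedding_pullback_map a).isOpenMap _ V.2⟩, ⟨S.1, hV, rfl⟩,
        homOfLE ?_, Q, ?_⟩
      · rintro _ ⟨T, hT, rfl⟩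
        exact i.le hT
      · rintro ⟨_, T, hT, rfl⟩
        refine hQ T _ ?_
        have h1 : t (p ⟨T, i.le hT⟩) = w ⟨T, i.le hT⟩ := ht _
        have h2 := hP ⟨T, hT⟩
        change P.Presents T (T.locMap a.map (t (p ⟨T, i.le hT⟩)))
        rw [h1]
        exact (congrArg (P.Presents T) (hw ⟨T, i.le hT⟩)).mpr h2
    · change S.1.locMap a.map (t (p S)) = _
      rw [ht, hw]

instance {A : RingCat.{u}} (a : Fraction A) : SheafedSpace.IsOpenImmersion (F.map a.map) where
  base_open := FullSpec.isOpenEmbedding_pullback_map a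
  c_iso _ := (ConcreteCategory.isIso_iff_bijective ((presheafMap a.map).app _)).2
    (sectionsMap_bijective a _ (Set.image_subset_range _ _))

theorem range_F_map {A : RingCat.{u}} (a : Fraction A) :
    Set.range (F.map a.map).hom.base = (D a : Set (FullSpec A)) :=
  FullSpec.range_pullback_map a

/-! ### Open subspaces of ringed spaces -/

/-- The inclusion of an open ringed subspace. -/
def openSub.ι (X : RSpace.{u}) (U : Opens X) : openSub X U ⟶ X :=
  X.ofRestrict U.isOpenEmbedding

instance (X : RSpace.{u}) (U : Opens X) : SheafedSpace.IsOpenImmersion (openSub.ι X U) :=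
  inferInstanceAs (SheafedSpace.IsOpenImmersion (X.ofRestrict U.isOpenEmbedding))

theorem openSub.range_ι (X : RSpace.{u}) (U : Opens X) :
    Set.range (openSub.ι X U).hom.base = (U : Set X) :=
  Subtype.range_coe

theorem nonempty_iso_of_range_eq {X Y Z : RSpace.{u}} (f : Y ⟶ X) (g : Z ⟶ X)
    [SheafedSpace.IsOpenImmersion f] [SheafedSpace.IsOpenImmersion g]
    (h : Set.range f.hom.base = Set.range g.hom.base) : Nonempty (Y ≅ Z) :=
  ⟨SheafedSpace.isoMk (PresheafedSpace.IsOpenImmersion.isoOfRangeEq f.hom g.hom h)⟩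

theorem nonempty_openSub_iso {X Y : RSpace.{u}} (f : Y ⟶ X) [SheafedSpace.IsOpenImmersion f]
    (U : Opens X) (h : Set.range f.hom.base = (U : Set X)) : Nonempty (openSub X U ≅ Y) :=
  nonempty_iso_of_range_eq (openSub.ι X U) f ((openSub.range_ι X U).trans h.symm)

theorem nontrivial_ring {A : RingCat.{u}} (a : Fraction A) (S : FullSpec A) (h : a.Mem S) :
    Nontrivial a.ring := by
  obtain ⟨g, -⟩ := (a.mem_iff S).1 h
  exact g.domain_nontrivial

/-- An affine neighbourhood of `x` need not lie in `U`. Its intersection with `U` contains a set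
`D(𝐚)` around `x`, which is affine by the first part. -/
theorem IsFScheme.openSub {X : RSpace.{u}} (hX : IsFScheme X) (U : Opens X) :
    IsFScheme (openSub X U) := by
  rintro ⟨x, hxU⟩
  obtain ⟨V, hxV, A, -, ⟨e⟩⟩ := hX x
  let f : F A ⟶ X := e.inv ≫ openSub.ι X V
  have hfe : e.hom ≫ f = openSub.ι X V := e.hom_inv_id_assoc _
  obtain ⟨S, hS⟩ : ∃ S : F A, f.hom.base S = x :=
    ⟨e.hom.hom.base ⟨x, hxV⟩,
      congrArg (fun k : FSch.openSub X V ⟶ X => k.hom.base ⟨x, hxV⟩) hfe⟩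
  obtain ⟨_, ⟨a, rfl⟩, hSa, haU⟩ := (isTopologicalBasis_D A).exists_subset_of_mem_open
    (a := S) (u := f.hom.base ⁻¹' (U : Set X)) (Set.mem_preimage.2 (hS ▸ hxU))
    (U.isOpen.preimage f.hom.base.hom.continuous)
  let g : F a.ring ⟶ X := F.map a.map ≫ f
  have hg : Set.range g.hom.base = f.hom.base '' {S : FullSpec A | a.Mem S} := 
    (Set.range_comp f.hom.base (FullSpec.pullback a.map)).trans
      (congrArg (f.hom.base '' ·) (FullSpec.range_pullback_map a))
  have hgU : Set.range g.hom.base ⊆ (U : Set X) := by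
    rw [hg]
    exact Set.image_subset_iff.2 haU
  have hgo : IsOpen (Set.range g.hom.base) :=
    (SheafedSpace.IsOpenImmersion.comp (F.map a.map) f).base_open.isOpen_range
  -- `W` is the image of `F(A_𝐚)` regarded inside `U`. It is identified with `F(A_𝐚)` by comparing
  -- two open immersions into `X` with the same range.
  let W : Opens (FSch.openSub X U) :=
    ⟨(openSub.ι X U).hom.base ⁻¹' Set.range g.hom.base,
      hgo.preimage (openSub.ι X U).hom.base.hom.continuous⟩
  refine ⟨W, ?_, a.ring, nontrivial_ring a S hSa, nonempty_iso_of_range_eq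
    (openSub.ι (FSch.openSub X U) W ≫ openSub.ι X U) g ?_⟩
  · change x ∈ Set.range g.hom.base
    rw [hg]
    exact ⟨S, hSa, hS⟩
  · refine (Set.range_comp (openSub.ι X U).hom.base _).trans ?_
    refine (congrArg ((openSub.ι X U).hom.base '' ·) (openSub.range_ι _ W)).trans ?_
    refine (Set.image_preimage_eq_inter_range (f := (openSub.ι X U).hom.base)
      (t := Set.range g.hom.base)).trans ?_
    exact Set.inter_eq_left.2 (hgU.trans (openSub.range_ι X U).ge)

end FSch

end

theorem mainTheorem4 :
    (∀ (A : RingCat.{u}) (a : FSch.Fraction A), (FSch.D a : Set (FSch.FullSpec A)).Nonempty →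
      Nontrivial a.ring ∧ Nonempty (FSch.openSub (FSch.F A) (FSch.D a) ≅ FSch.F a.ring)) ∧
    (∀ X : FSch.RSpace.{u}, FSch.IsFScheme X →
      ∀ U : TopologicalSpace.Opens X, FSch.IsFScheme (FSch.openSub X U)) :=
  ⟨fun _ a ⟨S, hS⟩ => ⟨FSch.nontrivial_ring a S hS,
    FSch.nonempty_openSub_iso (FSch.F.map a.map) (FSch.D a) (FSch.range_F_map a)⟩,
    fun _ hX U => hX.openSub U⟩
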